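/- Let $(\Omega,\mathcal F,P)$ be a complete probability space carrying a standard Brownian motion $W$, let $(\mathcal F_t)$ be the natural filtration of $W$ augmented to satisfy the usual conditions, let $\Theta\subset\mathbb R$ be compact and convex, and let $\mathcal A^\Theta$ be the set of $(\mathcal F_t)$-progressively measurable processes $\theta:[0,\infty)\times\Omega\to\Theta$ with $E_P\left[\int_0^t|\theta_s|^2\,ds\right]<\infty$ for all $t$. For $\theta\in\mathcal A^\Theta$ let $B^\theta_t=\int_0^t\theta_s\,dW_s$ (continuous version of the Itô integral). Fix $T\ge 0$ and a real $p\ge 1$. A cylinder function is a functional $\xi=\varphi(B_{t_1},\dots,B_{t_n})$ of the canonical process $B$ on the space of continuous paths starting at $0$, with $0\le t_1<\dots<t_n\le T$ and $\varphi:\mathbb R^n\to\mathbb R$ satisfying $|\varphi(x)-\varphi(y)|\le C(1+|x|^k+|y|^k)|x-y|$ for some $C\ge 0$, $k\in\mathbb N$. Put $\xi^\theta=\varphi(B^\theta_{t_1},\dots,B^\theta_{t_n})$, $\hat E[|\xi|^p]=\sup_{\theta\in\mathcal A^\Theta}E_P[|\xi^\theta|^p]$ and $\|\xi\|_{L_G^p}=\hat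 E[|\xi|^p]^{1/p}$. Let $L_G^p(\Omega_T)$ be the completion of the space of cylinder functions under this norm, extend $\hat E[|\cdot|^p]$ to it by continuity, and let $\Phi(X)=\{X^\theta\}_{\theta\in\mathcal A^\Theta}$ be the extension by continuity of $\xi\mapsto\{\xi^\theta\}_{\theta}$ with respect to the norm $\sup_\theta\|X^\theta\|_{L^p(P)}$ on families. **Theorem.** Let $X_n$ $(n\in\mathbb N)$ and $X$ be elements of $L_G^p(\Omega_T)$ with $\lim_{n\to\infty}\hat E[|X_n-X|^p]=0$, and write $\Phi(X_n)=\{X_n^\theta\}$, $\Phi(X)=\{X^\theta\}$. Then for every $\epsilon>0$, $$\lim_{n\to\infty}\ \sup_{\theta\in\mathcal A^\Theta}P\left(|X_n^\theta-X^\theta|>\epsilon\right)=0 .$$ -/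

import Mathlib

open MeasureTheory ProbabilityTheory Filter Topology
open scoped NNReal ENNReal

noncomputable section

namespace GExp

/-! ### The reference space and the admissible controls -/

/-- A complete probability space `(Ω, P)` supporting a standard Brownian motion `W`. -/
structure BrownianSetup (Ω : Type*) [MeasurableSpace Ω] where
  P : Measure Ω
  isProbability : IsProbabilityMeasure P
  isComplete : P.IsComplete
  W : ℝ≥0 → Ω → ℝ
  isBrownian : IsBrownianReal W P

variable {Ω : Type*} [mΩ : MeasurableSpace Ω]

instance (S : BrownianSetup Ω) : IsProbabilityMeasure S.P := S.isProbability

lemma BrownianSetup.measurable_W (S : BrownianSetup Ω) (t : ℝ≥0) : Measurable (S.W t) := by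
  intro A hA
  have h : AEMeasurable (S.W t) S.P := S.isBrownian.toIsPreBrownianReal.aemeasurable t
  have hn : NullMeasurableSet (S.W t ⁻¹' A) S.P := h.nullMeasurable hA
  have := S.isComplete
  exact hn.measurable_of_complete

/-- The natural filtration of `W`, completed by all `P`-null sets. -/
def BrownianSetup.completedFiltration (S : BrownianSetup Ω) : Filtration ℝ≥0 mΩ where
  seq t := (⨆ s ≤ t, MeasurableSpace.comap (S.W s) inferInstance) ⊔
    MeasurableSpace.generateFrom {N : Set Ω | S.P N = 0}
  mono' _ _ hij := sup_le_sup_right (biSup_mono fun _ => ge_trans hij) _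
  le' t := by
    refine sup_le (iSup₂_le fun s _ => (S.measurable_W s).comap_le) ?_
    refine MeasurableSpace.generateFrom_le fun N hN => ?_
    exact S.isComplete.out' N hN

/-- The natural filtration of `W` augmented to satisfy the usual conditions: the right-continuous
version of the completed natural filtration. -/
def BrownianSetup.filtration (S : BrownianSetup Ω) : Filtration ℝ≥0 mΩ :=
  S.completedFiltration.rightCont

/-- The admissible controls: progressively measurable processes with values in `Θ` that are
square integrable on `[0, T] × Ω` for every `T`. -/
def Control (S : BrownianSetup Ω) (Θ : Set ℝ) : Type _ :=
  {θ : ℝ≥0 → Ω → ℝ // (∀ t ω, θ t ω ∈ Θ) ∧ IsStronglyProgressive S.filtration θ ∧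
    ∀ T : ℝ≥0, ∫⁻ ω, (∫⁻ s in Set.Icc (0 : ℝ) T, ‖θ s.toNNReal ω‖ₑ ^ 2) ∂S.P < ∞}

/-! ### The Itô integral -/

/-- Simple processes `∑ i < n, cᵢ 1_{(tᵢ, tᵢ₊₁]}` with `cᵢ` bounded and `ℱ_{tᵢ}`-measurable. -/
structure SimpleProcess (S : BrownianSetup Ω) where
  n : ℕ
  time : ℕ → ℝ≥0
  mono : Monotone time
  coef : ℕ → Ω → ℝ
  measurable_coef : ∀ i, Measurable[S.filtration (time i)] (coef i)
  bounded_coef : ∀ i, ∃ K : ℝ, ∀ ω, |coef i ω| ≤ K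

/-- The value of a simple process at time `s`. -/
def SimpleProcess.value {S : BrownianSetup Ω} (H : SimpleProcess S) (s : ℝ≥0) (ω : Ω) : ℝ :=
  ∑ i ∈ Finset.range H.n, (Set.Ioc (H.time i) (H.time (i + 1))).indicator (fun _ => H.coef i ω) s

/-- The elementary stochastic integral `∫_0^t H dW`. -/
def SimpleProcess.integral {S : BrownianSetup Ω} (H : SimpleProcess S) (t : ℝ≥0) (ω : Ω) : ℝ :=
  ∑ i ∈ Finset.range H.n,
    H.coef i ω * (S.W (min (H.time (i + 1)) t) ω - S.W (min (H.time i) t) ω)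

/-- `Y = ∫_0^t θ dW` (Itô): `Y` is the `L²(P)`-limit of the elementary integrals of simple
processes that converge to `θ` in `L²([0, t] × Ω)`. -/
def IsItoIntegral (S : BrownianSetup Ω) (θ : ℝ≥0 → Ω → ℝ) (t : ℝ≥0) (Y : Ω → ℝ) : Prop :=
  AEStronglyMeasurable Y S.P ∧ ∃ H : ℕ → SimpleProcess S,
    Tendsto (fun n => ∫⁻ ω, (∫⁻ s in Set.Icc (0 : ℝ) t,
      ‖(H n).value s.toNNReal ω - θ s.toNNReal ω‖ₑ ^ 2) ∂S.P) atTop (𝓝 0) ∧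
    Tendsto (fun n => ∫⁻ ω, ‖(H n).integral t ω - Y ω‖ₑ ^ 2 ∂S.P) atTop (𝓝 0)

/-- The canonical path space: continuous real paths on `[0, ∞)` starting at `0`. -/
def PathSpace : Type := {x : C(ℝ≥0, ℝ) // x 0 = 0}

instance : CoeFun PathSpace fun _ => ℝ≥0 → ℝ := ⟨fun x => x.1⟩

instance : Zero PathSpace := ⟨⟨0, rfl⟩⟩

open scoped Classical in
/-- The controlled process `B^θ_t = ∫_0^t θ_s dW_s`, as a path-valued map: the continuous version
of the Itô integral process, which exists for every admissible control with values in a bounded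
set and is unique up to indistinguishability. (The value after `else` is only a formal default.) -/
def controlledPath (S : BrownianSetup Ω) {Θ : Set ℝ} (θ : Control S Θ) : Ω → PathSpace :=
  if h : ∃ B : Ω → PathSpace, ∀ t, IsItoIntegral S θ.1 t (fun ω => B ω t) then h.choose else 0

lemma aestronglyMeasurable_controlledPath (S : BrownianSetup Ω) {Θ : Set ℝ} (θ : Control S Θ)
    (t : ℝ≥0) : AEStronglyMeasurable (fun ω => controlledPath S θ ω t) S.P := by
  unfold controlledPath
  split_ifs with h
  · exact (h.choose_spec t).1
  · exact aestronglyMeasurable_const (b := (0 : ℝ))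

/-! ### Cylinder functions and the `G`-expectation -/

/-- The class `C_{l.Lip}`: locally Lipschitz functions whose local Lipschitz constant has at most
polynomial growth. -/
def IsClLip {ι : Type*} [Fintype ι] (φ : (ι → ℝ) → ℝ) : Prop :=
  ∃ C : ℝ, 0 ≤ C ∧ ∃ k : ℕ, ∀ x y, |φ x - φ y| ≤ C * (1 + ‖x‖ ^ k + ‖y‖ ^ k) * ‖x - y‖

/-- `ξ` is a cylinder function: `ξ = φ(B_{t₁}, …, B_{tₙ})` with `B` the canonical process on the
path space, finitely many times `t₁ < ⋯ < tₙ` in `[0, T]`, and `φ ∈ C_{l.Lip}(ℝⁿ)`. -/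
def IsCylinder (T : ℝ≥0) (ξ : PathSpace → ℝ) : Prop :=
  ∃ I : Finset ℝ≥0, (∀ t ∈ I, t ≤ T) ∧ ∃ φ : (I → ℝ) → ℝ, IsClLip φ ∧
    ∀ x : PathSpace, ξ x = φ fun t => x t

/-- The `G`-expectation of a path functional: the supremum over all admissible controls `θ` of the
linear expectation of `ξ(B^θ)`. -/
def gExpectation (S : BrownianSetup Ω) (Θ : Set ℝ) (ξ : PathSpace → ℝ) : ℝ :=
  ⨆ θ : Control S Θ, ∫ ω, ξ (controlledPath S θ ω) ∂S.P

lemma one_add_pow_le {k m : ℕ} (h : k ≤ m) {r : ℝ} (hr : 0 ≤ r) : r ^ k ≤ 1 + r ^ m := by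
  rcases le_total r 1 with h1 | h1
  · have := pow_le_one₀ hr h1 (n := k)
    have := pow_nonneg hr m
    linarith
  · have := pow_le_pow_right₀ h1 h
    linarith

lemma IsClLip.raise {ι : Type*} [Fintype ι] {φ : (ι → ℝ) → ℝ} {C : ℝ} (hC : 0 ≤ C) {k m : ℕ}
    (h : ∀ x y, |φ x - φ y| ≤ C * (1 + ‖x‖ ^ k + ‖y‖ ^ k) * ‖x - y‖) (hkm : k ≤ m) (x y : ι → ℝ) :
    |φ x - φ y| ≤ (3 * C) * (1 + ‖x‖ ^ m + ‖y‖ ^ m) * ‖x - y‖ := by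
  refine (h x y).trans (mul_le_mul_of_nonneg_right ?_ (norm_nonneg _))
  have h1 := one_add_pow_le hkm (norm_nonneg x)
  have h2 := one_add_pow_le hkm (norm_nonneg y)
  have h3 := pow_nonneg (norm_nonneg x) m
  have h4 := pow_nonneg (norm_nonneg y) m
  rw [mul_comm 3 C, mul_assoc]
  exact mul_le_mul_of_nonneg_left (by linarith) hC

lemma IsClLip.add {ι : Type*} [Fintype ι] {φ ψ : (ι → ℝ) → ℝ} (hφ : IsClLip φ) (hψ : IsClLip ψ) :
    IsClLip fun x => φ x + ψ x := by
  obtain ⟨C, hC, k, h⟩ := hφ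
  obtain ⟨D, hD, l, h'⟩ := hψ
  refine ⟨3 * C + 3 * D, by positivity, max k l, fun x y => ?_⟩
  have h1 := IsClLip.raise hC h (le_max_left k l) x y
  have h2 := IsClLip.raise hD h' (le_max_right k l) x y
  have h3 : φ x + ψ x - (φ y + ψ y) = (φ x - φ y) + (ψ x - ψ y) := by ring
  rw [h3]
  refine (abs_add_le _ _).trans ((add_le_add h1 h2).trans (le_of_eq (by ring)))

lemma IsClLip.const_mul {ι : Type*} [Fintype ι] {φ : (ι → ℝ) → ℝ} (hφ : IsClLip φ) (c : ℝ) :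
    IsClLip fun x => c * φ x := by
  obtain ⟨C, hC, k, h⟩ := hφ
  refine ⟨|c| * C, by positivity, k, fun x y => ?_⟩
  rw [← mul_sub, abs_mul, mul_assoc, mul_assoc, ← mul_assoc C]
  exact mul_le_mul_of_nonneg_left (h x y) (abs_nonneg c)

lemma IsClLip.comp {ι κ : Type*} [Fintype ι] [Fintype κ] {φ : (ι → ℝ) → ℝ} (hφ : IsClLip φ)
    (f : ι → κ) : IsClLip fun x : κ → ℝ => φ fun i => x (f i) := by
  have hn : ∀ x : κ → ℝ, ‖fun i => x (f i)‖ ≤ ‖x‖ := fun x =>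
    (pi_norm_le_iff_of_nonneg (norm_nonneg x)).2 fun i => norm_le_pi_norm x (f i)
  obtain ⟨C, hC, k, h⟩ := hφ
  refine ⟨C, hC, k, fun x y => (h _ _).trans ?_⟩
  have h1 : ‖fun i => x (f i)‖ ^ k ≤ ‖x‖ ^ k := pow_le_pow_left₀ (norm_nonneg _) (hn x) k
  have h2 : ‖fun i => y (f i)‖ ^ k ≤ ‖y‖ ^ k := pow_le_pow_left₀ (norm_nonneg _) (hn y) k
  exact mul_le_mul (mul_le_mul_of_nonneg_left (by linarith) hC) (hn (x - y)) (norm_nonneg _)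
    (by positivity)

lemma IsClLip.continuous {ι : Type*} [Fintype ι] {φ : (ι → ℝ) → ℝ} (hφ : IsClLip φ) :
    Continuous φ := by
  obtain ⟨C, hC, k, h⟩ := hφ
  refine continuous_iff_continuousAt.2 fun y => ?_
  rw [ContinuousAt, tendsto_iff_dist_tendsto_zero]
  refine squeeze_zero (fun _ => dist_nonneg) (fun x => h x y) ?_
  have : Continuous fun x : ι → ℝ => C * (1 + ‖x‖ ^ k + ‖y‖ ^ k) * ‖x - y‖ := by fun_prop
  simpa using this.tendsto y

lemma IsCylinder.add {T : ℝ≥0} {ξ η : PathSpace → ℝ} (hξ : IsCylinder T ξ) (hη : IsCylinder T η) :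
    IsCylinder T (ξ + η) := by
  obtain ⟨I, hI, φ, hφ, h⟩ := hξ
  obtain ⟨J, hJ, ψ, hψ, h'⟩ := hη
  refine ⟨I ∪ J, fun t ht => (Finset.mem_union.1 ht).elim (hI t) (hJ t), _,
    (hφ.comp fun t : I => (⟨t, Finset.mem_union_left J t.2⟩ : ↥(I ∪ J))).add
      (hψ.comp fun t : J => (⟨t, Finset.mem_union_right I t.2⟩ : ↥(I ∪ J))), fun x => ?_⟩
  simp [h, h']

lemma IsCylinder.smul {T : ℝ≥0} {ξ : PathSpace → ℝ} (hξ : IsCylinder T ξ) (c : ℝ) :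
    IsCylinder T (c • ξ) := by
  obtain ⟨I, hI, φ, hφ, h⟩ := hξ
  exact ⟨I, hI, _, hφ.const_mul c, fun x => by simp [h]⟩

lemma IsCylinder.zero (T : ℝ≥0) : IsCylinder T 0 :=
  ⟨∅, by simp, fun _ => 0, ⟨0, le_rfl, 0, by simp⟩, fun _ => rfl⟩

lemma IsCylinder.aestronglyMeasurable {T : ℝ≥0} {ξ : PathSpace → ℝ} (hξ : IsCylinder T ξ)
    (S : BrownianSetup Ω) {Θ : Set ℝ} (θ : Control S Θ) :
    AEStronglyMeasurable (fun ω => ξ (controlledPath S θ ω)) S.P := by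
  obtain ⟨I, -, φ, hφ, h⟩ := hξ
  simp_rw [h]
  refine hφ.continuous.comp_aestronglyMeasurable (AEMeasurable.aestronglyMeasurable ?_)
  exact aemeasurable_pi_lambda _ fun t =>
    (aestronglyMeasurable_controlledPath S θ t).aemeasurable

instance fact_one_le_ofReal (p : ℝ) [hp : Fact (1 ≤ p)] : Fact (1 ≤ ENNReal.ofReal p) :=
  ⟨ENNReal.one_le_ofReal.2 hp.out⟩

/-- The vector space of cylinder functions. The second clause, finiteness of the `L_G^p`-norm, holds
automatically for bounded `Θ`, since then all moments of `B^θ_t` are bounded uniformly in `θ`; it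
is recorded so that the norm below is real-valued by construction. -/
def cylinderSubmodule (S : BrownianSetup Ω) (Θ : Set ℝ) (T : ℝ≥0) (p : ℝ) [Fact (1 ≤ p)] :
    Submodule ℝ (PathSpace → ℝ) where
  carrier := {ξ | IsCylinder T ξ ∧
    ⨆ θ : Control S Θ, eLpNorm (fun ω => ξ (controlledPath S θ ω)) (ENNReal.ofReal p) S.P < ∞}
  zero_mem' := ⟨IsCylinder.zero T, by simp⟩
  add_mem' := by
    rintro ξ η ⟨h1, h2⟩ ⟨h3, h4⟩
    refine ⟨h1.add h3, lt_of_le_of_lt (iSup_le fun θ => ?_) (ENNReal.add_lt_top.2 ⟨h2, h4⟩)⟩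
    refine (eLpNorm_add_le (h1.aestronglyMeasurable S θ) (h3.aestronglyMeasurable S θ)
      (Fact.out : 1 ≤ ENNReal.ofReal p)).trans (add_le_add ?_ ?_)
    · exact le_iSup (fun θ : Control S Θ =>
        eLpNorm (fun ω => ξ (controlledPath S θ ω)) (ENNReal.ofReal p) S.P) θ
    · exact le_iSup (fun θ : Control S Θ =>
        eLpNorm (fun ω => η (controlledPath S θ ω)) (ENNReal.ofReal p) S.P) θ
  smul_mem' := by
    rintro c ξ ⟨h1, h2⟩
    refine ⟨h1.smul c, lt_of_le_of_lt (iSup_le fun θ => ?_)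
      (ENNReal.mul_lt_top (enorm_lt_top (x := c)) h2)⟩
    refine (eLpNorm_const_smul_le (c := c)
      (f := fun ω => ξ (controlledPath S θ ω))).trans (mul_le_mul_right ?_ _)
    exact le_iSup (fun θ : Control S Θ =>
        eLpNorm (fun ω => ξ (controlledPath S θ ω)) (ENNReal.ofReal p) S.P) θ

/-- The space `𝒞_T` of cylinder functions, to be normed by `‖ξ‖ = Ê[|ξ|^p]^{1/p}`. -/
def Cyl (S : BrownianSetup Ω) (Θ : Set ℝ) (T : ℝ≥0) (p : ℝ) [Fact (1 ≤ p)] : Type :=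
  cylinderSubmodule S Θ T p

section

variable (S : BrownianSetup Ω) (Θ : Set ℝ) (T : ℝ≥0) (p : ℝ) [hp : Fact (1 ≤ p)]

instance : AddCommGroup (Cyl S Θ T p) := inferInstanceAs (AddCommGroup (cylinderSubmodule S Θ T p))

instance : Module ℝ (Cyl S Θ T p) := inferInstanceAs (Module ℝ (cylinderSubmodule S Θ T p))

/-- The space of families `{X^θ}` of elements of `L^p(P)` indexed by the admissible controls, with
`sup_θ ‖X^θ‖_{L^p(P)} < ∞`, normed by this supremum. -/
abbrev ParamFamily : Type _ := lp (fun _ : Control S Θ => Lp ℝ (ENNReal.ofReal p) S.P) ∞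

variable {S Θ T p}

lemma Cyl.eLpNorm_le (ξ : Cyl S Θ T p) (θ : Control S Θ) :
    eLpNorm (fun ω => ξ.1 (controlledPath S θ ω)) (ENNReal.ofReal p) S.P ≤
      ⨆ θ : Control S Θ, eLpNorm (fun ω => ξ.1 (controlledPath S θ ω)) (ENNReal.ofReal p) S.P :=
  le_iSup (fun θ : Control S Θ =>
    eLpNorm (fun ω => ξ.1 (controlledPath S θ ω)) (ENNReal.ofReal p) S.P) θ

lemma Cyl.memLp (ξ : Cyl S Θ T p) (θ : Control S Θ) :
    MemLp (fun ω => ξ.1 (controlledPath S θ ω)) (ENNReal.ofReal p) S.P :=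
  ⟨ξ.2.1.aestronglyMeasurable S θ, (ξ.eLpNorm_le θ).trans_lt ξ.2.2⟩

/-- `Φ` on cylinder functions: `ξ ↦ {ξ^θ}` with `ξ^θ = φ(B^θ_{t₁}, …, B^θ_{tₙ}) = ξ(B^θ)`. -/
def cylPhi : Cyl S Θ T p →ₗ[ℝ] ParamFamily S Θ p where
  toFun ξ := ⟨fun θ => (ξ.memLp θ).toLp _, memℓp_infty
    ⟨(⨆ θ : Control S Θ,
      eLpNorm (fun ω => ξ.1 (controlledPath S θ ω)) (ENNReal.ofReal p) S.P).toReal, by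
      rintro _ ⟨θ, rfl⟩
      simp only [Lp.norm_toLp]
      exact ENNReal.toReal_mono ξ.2.2.ne (ξ.eLpNorm_le θ)⟩⟩
  map_add' _ _ := rfl
  map_smul' _ _ := rfl

instance : Norm (Cyl S Θ T p) :=
  ⟨fun ξ => gExpectation S Θ (fun x => |ξ.1 x| ^ p) ^ (1 / p)⟩

lemma Cyl.integral_eq (ξ : Cyl S Θ T p) (θ : Control S Θ) :
    ∫ ω, |ξ.1 (controlledPath S θ ω)| ^ p ∂S.P = ‖(cylPhi ξ : ParamFamily S Θ p) θ‖ ^ p := by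
  have hp0 : 0 < p := lt_of_lt_of_le one_pos hp.out
  have h : ‖(cylPhi ξ : ParamFamily S Θ p) θ‖ =
      (eLpNorm (fun ω => ξ.1 (controlledPath S θ ω)) (ENNReal.ofReal p) S.P).toReal :=
    Lp.norm_toLp _ (ξ.memLp θ)
  rw [h, (ξ.memLp θ).eLpNorm_eq_integral_rpow_norm (by simpa using hp0) ENNReal.ofReal_ne_top,
    ENNReal.toReal_ofReal hp0.le, ENNReal.toReal_ofReal (by positivity),
    ← Real.rpow_mul (by positivity), inv_mul_cancel₀ hp0.ne', Real.rpow_one]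
  rfl

lemma Cyl.norm_eq (ξ : Cyl S Θ T p) : ‖ξ‖ = ‖cylPhi ξ‖ := by
  have hp0 : 0 < p := lt_of_lt_of_le one_pos hp.out
  change gExpectation S Θ (fun x => |ξ.1 x| ^ p) ^ (1 / p) = _
  simp only [gExpectation, Cyl.integral_eq]
  rw [lp.norm_eq_ciSup]
  have hb : BddAbove (Set.range fun θ : Control S Θ => ‖(cylPhi ξ : ParamFamily S Θ p) θ‖) :=
    (lp.memℓp (cylPhi ξ : ParamFamily S Θ p)).bddAbove
  rcases isEmpty_or_nonempty (Control S Θ) with he | he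
  · rw [Real.iSup_of_isEmpty, Real.iSup_of_isEmpty, Real.zero_rpow (by positivity)]
  have h0 : 0 ≤ ⨆ θ : Control S Θ, ‖(cylPhi ξ : ParamFamily S Θ p) θ‖ :=
    Real.iSup_nonneg fun _ => norm_nonneg _
  have hle : ∀ θ : Control S Θ, ‖(cylPhi ξ : ParamFamily S Θ p) θ‖ ^ p ≤
      (⨆ θ : Control S Θ, ‖(cylPhi ξ : ParamFamily S Θ p) θ‖) ^ p := fun θ =>
    Real.rpow_le_rpow (norm_nonneg _) (le_ciSup hb θ) hp0.le
  have h1 : 0 ≤ ⨆ θ : Control S Θ, ‖(cylPhi ξ : ParamFamily S Θ p) θ‖ ^ p :=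
    Real.iSup_nonneg fun _ => by positivity
  apply le_antisymm
  · refine (Real.rpow_le_rpow h1 (ciSup_le hle) (by positivity)).trans (le_of_eq ?_)
    rw [← Real.rpow_mul h0, mul_one_div_cancel hp0.ne', Real.rpow_one]
  · refine ciSup_le fun θ => ?_
    have h2 := le_ciSup (f := fun θ : Control S Θ => ‖(cylPhi ξ : ParamFamily S Θ p) θ‖ ^ p)
      ⟨_, by rintro _ ⟨θ, rfl⟩; exact hle θ⟩ θ
    have h3 := Real.rpow_le_rpow (by positivity) h2 (z := 1 / p) (by positivity)
    simpa only [← Real.rpow_mul (norm_nonneg _), mul_one_div_cancel hp0.ne', Real.rpow_one] using h3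

lemma Cyl.core : SeminormedSpace.Core ℝ (Cyl S Θ T p) where
  norm_nonneg ξ := by rw [Cyl.norm_eq]; exact norm_nonneg _
  norm_smul c ξ := by rw [Cyl.norm_eq, Cyl.norm_eq, map_smul, norm_smul]
  norm_triangle ξ η := by
    rw [Cyl.norm_eq, Cyl.norm_eq, Cyl.norm_eq, map_add]; exact norm_add_le _ _

instance : SeminormedAddCommGroup (Cyl S Θ T p) := SeminormedAddCommGroup.ofCore Cyl.core

instance : NormedSpace ℝ (Cyl S Θ T p) :=
  { norm_smul_le := fun c ξ => (Cyl.core.norm_smul c ξ).le }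

end

/-! ### The space `L_G^p(Ω_T)` and the map `Φ` -/

section

variable (S : BrownianSetup Ω) (Θ : Set ℝ) (T : ℝ≥0) (p : ℝ) [hp : Fact (1 ≤ p)]

/-- `L_G^p(Ω_T)`: the completion of the cylinder functions under `‖ξ‖ = Ê[|ξ|^p]^{1/p}`. -/
abbrev LG : Type _ := UniformSpace.Completion (Cyl S Θ T p)

variable {S Θ T p}

/-- `X ↦ Ê[|X|^p]` on `L_G^p(Ω_T)`: the extension by continuity of `ξ ↦ Ê[|ξ|^p]` on cylinder
functions. -/
def absMoment (X : LG S Θ T p) : ℝ :=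
  UniformSpace.Completion.isDenseInducing_coe.extend
    (fun ξ : Cyl S Θ T p => gExpectation S Θ fun x => |ξ.1 x| ^ p) X

/-- The map `Φ : X ↦ {X^θ}` on `L_G^p(Ω_T)`: the extension by continuity of `Φ` on cylinder
functions, for the norm `sup_θ ‖X^θ‖_{L^p(P)}` on families. -/
def Phi (X : LG S Θ T p) : ParamFamily S Θ p :=
  UniformSpace.Completion.extension (cylPhi : Cyl S Θ T p → ParamFamily S Θ p) X

end

end GExp

end

namespace GExp

variable {Ω : Type*} [mΩ : MeasurableSpace Ω] {S : BrownianSetup Ω} {Θ : Set ℝ} {T : ℝ≥0} {p : ℝ}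
  [hp : Fact (1 ≤ p)]

/-! The completion is built so that `Φ` is an isometry: on cylinder functions `Ê[|ξ|^p]^{1/p}` is
exactly the supremum over θ of the `L^p(P)` norms of `ξ^θ`, and isometries extend to completions
(`isometry_Phi`). The extended moment `Ê[|X|^p]` is `‖X‖^p` (`absMoment_eq_norm_rpow`). Hence every
`‖X_n^θ - X^θ‖` in `L^p(P)` is at most `‖X_n - X‖`, a bound free of θ, and Markov's inequality for
each θ gives a tail bound `ε^{-p} Ê[|X_n - X|^p]` that survives the supremum. -/

/-- `Φ` as a linear isometry on cylinder functions. -/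
noncomputable def cylPhiIsometry : Cyl S Θ T p →ₗᵢ[ℝ] ParamFamily S Θ p where
  toLinearMap := cylPhi
  norm_map' ξ := (Cyl.norm_eq ξ).symm

/-- The target is complete, and preservation of distances passes from the dense subspace of cylinder
functions to its completion. -/
lemma isometry_Phi : Isometry (Phi : LG S Θ T p → ParamFamily S Θ p) :=
  (cylPhiIsometry (S := S) (Θ := Θ) (T := T) (p := p)).isometry.completion_extension

lemma gExpectation_abs_rpow (ξ : Cyl S Θ T p) :
    gExpectation S Θ (fun x => |ξ.1 x| ^ p) = ‖ξ‖ ^ p := by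
  have hp0 : 0 < p := one_pos.trans_le hp.out
  -- Nonnegativity is what allows the root `1 / p` in the norm to be undone by the power `p`.
  have h0 : 0 ≤ gExpectation S Θ (fun x => |ξ.1 x| ^ p) :=
    Real.iSup_nonneg fun θ => integral_nonneg fun ω => Real.rpow_nonneg (abs_nonneg _) p
  change _ = (gExpectation S Θ (fun x => |ξ.1 x| ^ p) ^ (1 / p)) ^ p
  rw [← Real.rpow_mul h0, one_div_mul_cancel hp0.ne', Real.rpow_one]

/-- Both sides agree on the dense cylinder functions, and `‖·‖ ^ p` is continuous, so it must be the
extension by continuity. -/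
lemma absMoment_eq_norm_rpow (X : LG S Θ T p) : absMoment X = ‖X‖ ^ p := by
  have hp0 : 0 < p := one_pos.trans_le hp.out
  have hc : Continuous fun Y : LG S Θ T p => ‖Y‖ ^ p :=
    continuous_norm.rpow_const fun _ => Or.inr hp0.le
  refine congrFun (UniformSpace.Completion.isDenseInducing_coe.extend_unique (fun ξ => ?_) hc) X
  simp only [UniformSpace.Completion.norm_coe, gExpectation_abs_rpow]

/-- Markov's inequality, uniformly in the control. -/
lemma iSup_measure_abs_Phi_sub_gt_le (X Y : LG S Θ T p) {ε : ℝ} (hε : 0 < ε) :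
    ⨆ θ : Control S Θ, S.P {ω | ε < |Phi X θ ω - Phi Y θ ω|} ≤
      ENNReal.ofReal ε⁻¹ ^ p * ENNReal.ofReal (absMoment (X - Y)) := by
  have hp0 : 0 < p := one_pos.trans_le hp.out
  refine iSup_le fun θ => ?_
  have hq : ENNReal.ofReal p ≠ 0 := by simpa using hp0
  -- Subtraction of `L^p` classes matches that of representatives only almost surely. The null set
  -- may depend on θ, harmlessly, since each θ is treated separately.
  have hs : (⇑(Phi X θ - Phi Y θ) : Ω → ℝ) =ᵐ[S.P] fun ω => Phi X θ ω - Phi Y θ ω :=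
    Lp.coeFn_sub _ _
  have hm := meas_ge_le_mul_pow_eLpNorm_enorm S.P hq ENNReal.ofReal_ne_top
    (Lp.aestronglyMeasurable (Phi X θ - Phi Y θ)) (ε := ENNReal.ofReal ε) (by simpa using hε)
    (by simp)
  -- Passing through distances uses only the isometry, so additivity of the extended `Φ` is not
  -- needed. A coordinate is bounded by the supremum norm of the family.
  have hn : ‖Phi X θ - Phi Y θ‖ ≤ ‖X - Y‖ := by
    rw [← dist_eq_norm X Y, ← isometry_Phi.dist_eq, dist_eq_norm]
    exact lp.norm_apply_le_norm ENNReal.top_ne_zero (Phi X - Phi Y) θ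
  have he : eLpNorm (⇑(Phi X θ - Phi Y θ)) (ENNReal.ofReal p) S.P ≤ ENNReal.ofReal ‖X - Y‖ := by
    rw [← Lp.enorm_def, ← ofReal_norm]
    exact ENNReal.ofReal_le_ofReal hn
  rw [ENNReal.toReal_ofReal hp0.le, ← ENNReal.ofReal_inv_of_pos hε] at hm
  rw [absMoment_eq_norm_rpow, ← ENNReal.ofReal_rpow_of_nonneg (norm_nonneg _) hp0.le]
  refine (measure_mono_ae ?_).trans (hm.trans (by gcongr))
  filter_upwards [hs] with ω hω hlt
  change ENNReal.ofReal ε ≤ ‖(Phi X θ - Phi Y θ) ω‖ₑ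
  rw [hω, ← ofReal_norm]
  exact ENNReal.ofReal_le_ofReal (le_of_lt hlt)

end GExp

theorem mainTheorem6 {Ω : Type*} [MeasurableSpace Ω] (S : GExp.BrownianSetup Ω)
    (Θ : Set ℝ) (hΘ_compact : IsCompact Θ) (hΘ_convex : Convex ℝ Θ)
    (T : ℝ≥0) (p : ℝ) [Fact (1 ≤ p)]
    (X : ℕ → GExp.LG S Θ T p) (X' : GExp.LG S Θ T p)
    (hX : Tendsto (fun n => GExp.absMoment (X n - X')) atTop (𝓝 0)) :
    ∀ ε : ℝ, 0 < ε →
      Tendsto (fun n => ⨆ θ : GExp.Control S Θ,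
        S.P {ω | ε < |GExp.Phi (X n) θ ω - GExp.Phi X' θ ω|}) atTop (𝓝 0) := by
  intro ε hε
  have hp0 : 0 ≤ p := zero_le_one.trans Fact.out
  -- The Markov constant must be finite, as multiplication by `∞` is not continuous at `0`.
  have h := ENNReal.Tendsto.const_mul (a := ENNReal.ofReal ε⁻¹ ^ p) (ENNReal.tendsto_ofReal hX)
    (Or.inr (ENNReal.rpow_ne_top_of_nonneg hp0 ENNReal.ofReal_ne_top))
  rw [ENNReal.ofReal_zero, mul_zero] at h
  exact tendsto_of_tendsto_of_tendsto_of_le_of_le tendsto_const_nhds h (fun _ => zero_le)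
    fun n => GExp.iSup_measure_abs_Phi_sub_gt_le (X n) X' hε
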